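/- Let $m,n\ge 0$ be integers, and let $N\ge0$ denote an arbitrary integer. Let $e_1,\dots,e_{m+n}$ be the standard basis of the superspace $\mathbb C^{m|n}$, with parity $p_i=p(e_i)=0$ for $i\le m$ and $p_i=1$ for $i>m$. Let $\mathfrak{gl}(m,n)$ be the space of complex $(m+n)\times(m+n)$ matrices with matrix units $E_{ij}$ of parity $p_{ij}=p_i+p_j$ (mod $2$), matrix product $\langle XY\rangle$ and superbracket $[X,Y]=\langle XY\rangle-(-1)^{p(X)p(Y)}\langle YX\rangle$ for homogeneous $X,Y$. Let $S(\mathfrak{gl}(m,n))$ and $U(\mathfrak{gl}(m,n))$ be the quotients of the tensor algebra of $\mathfrak{gl}(m,n)$ by the relations $XY=(-1)^{p(X)p(Y)}YX$ and $XY-(-1)^{p(X)p(Y)}YX=[X,Y]$ ($X,Y$ homogeneous), respectively. *Special symmetrization.* For homogeneous $Y_1,\dots,Y_k,X\in\mathfrak{gl}(m,n)$ put, in $S(\mathfrak{gl}(m,n))$, $$(Y_1\cdots Y_k)*X=Y_1\cdots Y_kX+\sum_{r=1}^k(-1)^{p(X)\sum_{s>r}p(Y_s)}\,Y_1\cdots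 Y_{r-1}\langle Y_rX\rangle Y_{r+1}\cdots Y_k .$$ This gives a well-defined bilinear map $S(\mathfrak{gl}(m,n))\times\mathfrak{gl}(m,n)\to S(\mathfrak{gl}(m,n))$, and there is a well-defined linear map $\tilde\sigma:U(\mathfrak{gl}(m,n))\to S(\mathfrak{gl}(m,n))$ with $\tilde\sigma(1)=1$ and $\tilde\sigma(X_1X_2\cdots X_k)=(\cdots((X_1*X_2)*X_3)\cdots)*X_k$. *Action of $U$.* The algebra $U(\mathfrak{gl}(m,n))$ acts on $(\mathbb C^{m|n})^{\otimes N}$ by the $N$-th tensor power of the vector representation: for homogeneous $X,v_1,\dots,v_N$, $$X(v_1\otimes\cdots\otimes v_N)=\sum_{t=1}^N(-1)^{p(X)(p(v_1)+\cdots+p(v_{t-1}))}\,v_1\otimes\cdots\otimes Xv_t\otimes\cdots\otimes v_N .$$ *Action of $S$ (linear in $a\in S(\mathfrak{gl}(m,n))$, not a representation).* For a monomial $E_{m_1l_1}\cdots E_{m_rl_r}\in S(\mathfrak{gl}(m,n))$ and a basis vector $e_{j_1}\otimes\cdots\otimes e_{j_N}$ build a tree of signed sequences of subscripts. Its root is $(j_1,\dots,j_N)$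 with sign $+1$. At step $s=1,\dots,r$ put $(a,b)=(m_{r+1-s},l_{r+1-s})$; each sequence $(k_1,\dots,k_N)$ of the preceding level generates one new sequence for every place $t$ such that $k_t=b$ and the place $t$ has not been changed in the steps $1,\dots,s-1$ on the path leading to this sequence; in the new sequence $k_t=b$ is replaced by $a$ (this counts as a change of the place $t$ even if $a=b$), and the sign is multiplied by $(-1)^{(p_{k_1}+\cdots+p_{k_{t-1}})\,p_{ab}}$. Then $(E_{m_1l_1}\cdots E_{m_rl_r})(e_{j_1}\otimes\cdots\otimes e_{j_N})$ is the sum of $\pm e_{k_1}\otimes\cdots\otimes e_{k_N}$ over the signed sequences on the last level of the tree. This does not depend on the way the monomial is written and extends linearly to $S(\mathfrak{gl}(m,n))$. **Corollary 2.3.** The map $\tilde\sigma$ is bijective, and with the special symmetrization $\sigma=\tilde\sigma^{-1}:S(\mathfrak{gl}(m,n))\to U(\mathfrak{gl}(m,n))$, for every $N\ge0$, every $a\in S(\mathfrak{gl}(m,n))$ and its image $\sigma(a)\in U(\mathfrak{gl}(m,n))$ act identically on $(\mathbb C^{m|n})^{\otimes N}$. -/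

import Mathlib

open scoped TensorProduct

noncomputable section

namespace SuperGL

/-- Indices `1, …, m + n` of the standard basis of `ℂ^{m|n}`: `inl` even, `inr` odd. -/
abbrev Idx (m n : ℕ) : Type := Fin m ⊕ Fin n

/-- Parity of a basis vector. -/
def par {m n : ℕ} : Idx m n → ZMod 2 := Sum.elim (fun _ => 0) (fun _ => 1)

/-- The sign `(-1)^a`. -/
def sgn (a : ZMod 2) : ℂ := (-1) ^ a.val

lemma sgn_add (a b : ZMod 2) : sgn (a + b) = sgn a * sgn b := by
  revert a b
  have h : ∀ a : ZMod 2, a = 0 ∨ a = 1 := by decide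
  intro a b
  have h2 : (1 : ZMod 2) + 1 = 0 := by decide
  have v0 : (0 : ZMod 2).val = 0 := rfl
  have v1 : (1 : ZMod 2).val = 1 := rfl
  rcases h a with rfl | rfl <;> rcases h b with rfl | rfl <;> simp [sgn, h2, v1]

lemma sgn_mul_self (a : ZMod 2) : sgn a * sgn a = 1 := by
  rw [← sgn_add, CharTwo.add_self_eq_zero]
  simp [sgn]

/-- The space of matrices underlying `gl(m,n)`; its matrix product is the product `⟨X Y⟩`. -/
abbrev Gl (m n : ℕ) : Type := Matrix (Idx m n) (Idx m n) ℂ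

/-- The matrix unit `E_{ij}`. -/
abbrev E {m n : ℕ} (i j : Idx m n) : Gl m n := Matrix.single i j 1

/-- `X` is homogeneous of parity `p` (the zero matrix has both parities). -/
def IsHom {m n : ℕ} (p : ZMod 2) (X : Gl m n) : Prop :=
  ∀ i j, X i j ≠ 0 → par i + par j = p

/-- The component of parity `p` of a matrix. -/
def homPart {m n : ℕ} (p : ZMod 2) : Gl m n →ₗ[ℂ] Gl m n where
  toFun X := Matrix.of fun i j => if par i + par j = p then X i j else 0
  map_add' X Y := by
    ext i j
    by_cases h : par i + par j = p <;> simp [h]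
  map_smul' c X := by
    ext i j
    by_cases h : par i + par j = p <;> simp [h]

lemma homPart_of_isHom {m n : ℕ} {p : ZMod 2} {X : Gl m n} (hX : IsHom p X) (q : ZMod 2) :
    homPart q X = if q = p then X else 0 := by
  ext i j
  by_cases hx : X i j = 0
  · by_cases hq : q = p <;> simp [homPart, hx, hq]
  · have := hX i j hx
    by_cases hq : q = p
    · simp [homPart, this, hq]
    · simp [homPart, this, hq, Ne.symm hq]

lemma isHom_E {m n : ℕ} (i j : Idx m n) : IsHom (par i + par j) (E i j) := by
  intro a b h
  by_cases h1 : i = a ∧ j = b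
  · rw [h1.1, h1.2]
  · exact absurd (Matrix.single_apply_of_ne i j 1 a b h1) h

lemma IsHom.mul {m n : ℕ} {p q : ZMod 2} {X Y : Gl m n} (hX : IsHom p X) (hY : IsHom q Y) :
    IsHom (p + q) (X * Y) := by
  intro i j h
  rw [Matrix.mul_apply] at h
  obtain ⟨k, -, hk⟩ := Finset.exists_ne_zero_of_sum_ne_zero h
  rw [← hX i k (left_ne_zero_of_mul hk), ← hY k j (right_ne_zero_of_mul hk)]
  have : par k + par k = 0 := CharTwo.add_self_eq_zero _
  linear_combination -this

/-- A bilinear identity with signs that holds on matrix units holds on homogeneous matrices. -/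
lemma swap_of_units {m n : ℕ} {B : Type*} [AddCommMonoid B] [Module ℂ B]
    (F : Gl m n →ₗ[ℂ] Gl m n →ₗ[ℂ] B)
    (h : ∀ i j k l, F (E i j) (E k l) =
      sgn ((par i + par j) * (par k + par l)) • F (E k l) (E i j))
    {p q : ZMod 2} {X Y : Gl m n} (hX : IsHom p X) (hY : IsHom q Y) :
    F X Y = sgn (p * q) • F Y X := by
  have eX : X = ∑ i, ∑ j, X i j • E i j := by
    conv_lhs => rw [Matrix.matrix_eq_sum_single X]
    simp [E, Matrix.smul_single]
  have eY : Y = ∑ i, ∑ j, Y i j • E i j := by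
    conv_lhs => rw [Matrix.matrix_eq_sum_single Y]
    simp [E, Matrix.smul_single]
  have key : ∀ i j k l, (X i j * Y k l) • F (E i j) (E k l) =
      sgn (p * q) • (X i j * Y k l) • F (E k l) (E i j) := by
    intro i j k l
    by_cases hx : X i j = 0
    · simp [hx]
    by_cases hy : Y k l = 0
    · simp [hy]
    rw [h, hX i j hx, hY k l hy, smul_comm]
  have e1 : F X Y = ∑ i, ∑ j, ∑ k, ∑ l, (X i j * Y k l) • F (E i j) (E k l) := by
    change F.flip Y X = _
    conv_lhs => rw [eX, eY]
    simp only [map_sum, LinearMap.sum_apply, map_smul, LinearMap.smul_apply, Finset.smul_sum,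
      smul_smul, LinearMap.flip_apply]
  have e2 : F Y X = ∑ i, ∑ j, ∑ k, ∑ l, (X i j * Y k l) • F (E k l) (E i j) := by
    conv_lhs => rw [eX, eY]
    simp only [map_sum, LinearMap.sum_apply, map_smul, LinearMap.smul_apply, Finset.smul_sum,
      smul_smul]
  rw [e1, e2]
  simp only [Finset.smul_sum, key]

/-! ### The symmetric and the universal enveloping superalgebra -/

/-- Defining relations of `S(gl(m,n))`: `X Y = (-1)^{p(X)p(Y)} Y X` for homogeneous `X`, `Y`. -/
inductive SymRel (m n : ℕ) :
    TensorAlgebra ℂ (Gl m n) → TensorAlgebra ℂ (Gl m n) → Prop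
  | swap {p q : ZMod 2} {X Y : Gl m n} (hX : IsHom p X) (hY : IsHom q Y) :
      SymRel m n (TensorAlgebra.ι ℂ X * TensorAlgebra.ι ℂ Y)
        (sgn (p * q) • (TensorAlgebra.ι ℂ Y * TensorAlgebra.ι ℂ X))

/-- The symmetric algebra `S(gl(m,n))` (in the super sense). -/
def SymAlg (m n : ℕ) : Type := RingQuot (SymRel m n)

instance (m n : ℕ) : Ring (SymAlg m n) := inferInstanceAs (Ring (RingQuot (SymRel m n)))

instance (m n : ℕ) : Algebra ℂ (SymAlg m n) :=
  inferInstanceAs (Algebra ℂ (RingQuot (SymRel m n)))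

/-- The quotient map `T(gl(m,n)) → S(gl(m,n))`. -/
def symMk (m n : ℕ) : TensorAlgebra ℂ (Gl m n) →ₐ[ℂ] SymAlg m n :=
  RingQuot.mkAlgHom ℂ (SymRel m n)

/-- Defining relations of `U(gl(m,n))`: `X Y - (-1)^{p(X)p(Y)} Y X = [X, Y]` for homogeneous
`X`, `Y`, where `[X, Y] = ⟨X Y⟩ - (-1)^{p(X)p(Y)} ⟨Y X⟩` is the superbracket of `gl(m,n)`. -/
inductive EnvRel (m n : ℕ) :
    TensorAlgebra ℂ (Gl m n) → TensorAlgebra ℂ (Gl m n) → Prop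
  | bracket {p q : ZMod 2} {X Y : Gl m n} (hX : IsHom p X) (hY : IsHom q Y) :
      EnvRel m n
        (TensorAlgebra.ι ℂ X * TensorAlgebra.ι ℂ Y
          - sgn (p * q) • (TensorAlgebra.ι ℂ Y * TensorAlgebra.ι ℂ X))
        (TensorAlgebra.ι ℂ (X * Y - sgn (p * q) • (Y * X)))

/-- The universal enveloping algebra `U(gl(m,n))`. -/
def EnvAlg (m n : ℕ) : Type := RingQuot (EnvRel m n)

instance (m n : ℕ) : Ring (EnvAlg m n) := inferInstanceAs (Ring (RingQuot (EnvRel m n)))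

instance (m n : ℕ) : Algebra ℂ (EnvAlg m n) :=
  inferInstanceAs (Algebra ℂ (RingQuot (EnvRel m n)))

/-- The quotient map `T(gl(m,n)) → U(gl(m,n))`. -/
def envMk (m n : ℕ) : TensorAlgebra ℂ (Gl m n) →ₐ[ℂ] EnvAlg m n :=
  RingQuot.mkAlgHom ℂ (EnvRel m n)

variable {m n : ℕ}

/-- The inclusion `gl(m,n) → S(gl(m,n))`. -/
def symι : Gl m n →ₗ[ℂ] SymAlg m n :=
  (symMk m n).toLinearMap ∘ₗ TensorAlgebra.ι ℂ

/-- The canonical map `gl(m,n) → U(gl(m,n))`. -/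
def envι : Gl m n →ₗ[ℂ] EnvAlg m n :=
  (envMk m n).toLinearMap ∘ₗ TensorAlgebra.ι ℂ

/-- Universal property of `S(gl(m,n))`. -/
def symLift {B : Type*} [Ring B] [Algebra ℂ B] (f : Gl m n →ₗ[ℂ] B)
    (h : ∀ ⦃p q : ZMod 2⦄ ⦃X Y : Gl m n⦄, IsHom p X → IsHom q Y →
      f X * f Y = sgn (p * q) • (f Y * f X)) : SymAlg m n →ₐ[ℂ] B :=
  RingQuot.liftAlgHom ℂ ⟨TensorAlgebra.lift ℂ f, by
    rintro _ _ ⟨hX, hY⟩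
    simpa using h hX hY⟩

/-- Universal property of `U(gl(m,n))`. -/
def envLift {B : Type*} [Ring B] [Algebra ℂ B] (f : Gl m n →ₗ[ℂ] B)
    (h : ∀ ⦃p q : ZMod 2⦄ ⦃X Y : Gl m n⦄, IsHom p X → IsHom q Y →
      f X * f Y - sgn (p * q) • (f Y * f X) = f (X * Y - sgn (p * q) • (Y * X))) :
    EnvAlg m n →ₐ[ℂ] B :=
  RingQuot.liftAlgHom ℂ ⟨TensorAlgebra.lift ℂ f, by
    rintro _ _ ⟨hX, hY⟩
    simpa using h hX hY⟩

@[simp] lemma symLift_symι {B : Type*} [Ring B] [Algebra ℂ B] (f : Gl m n →ₗ[ℂ] B)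
    (h : ∀ ⦃p q : ZMod 2⦄ ⦃X Y : Gl m n⦄, IsHom p X → IsHom q Y →
      f X * f Y = sgn (p * q) • (f Y * f X)) (X : Gl m n) :
    symLift f h (symι X) = f X := by
  exact (RingQuot.liftAlgHom_mkAlgHom_apply ℂ _ _ _).trans (TensorAlgebra.lift_ι_apply _ _)

@[simp] lemma envLift_envι {B : Type*} [Ring B] [Algebra ℂ B] (f : Gl m n →ₗ[ℂ] B)
    (h : ∀ ⦃p q : ZMod 2⦄ ⦃X Y : Gl m n⦄, IsHom p X → IsHom q Y →
      f X * f Y - sgn (p * q) • (f Y * f X) = f (X * Y - sgn (p * q) • (Y * X))) (X : Gl m n) :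
    envLift f h (envι X) = f X := by
  exact (RingQuot.liftAlgHom_mkAlgHom_apply ℂ _ _ _).trans (TensorAlgebra.lift_ι_apply _ _)

lemma symι_swap {p q : ZMod 2} {X Y : Gl m n} (hX : IsHom p X) (hY : IsHom q Y) :
    symι X * symι Y = sgn (p * q) • (symι Y * symι X) := by
  have h : symMk m n _ = symMk m n _ := RingQuot.mkAlgHom_rel ℂ (SymRel.swap hX hY)
  simpa [symι] using h

lemma sym_induction {P : SymAlg m n → Prop} (one : P 1)
    (add : ∀ a b, P a → P b → P (a + b)) (smul : ∀ (c : ℂ) a, P a → P (c • a))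
    (mul : ∀ a i j, P a → P (a * symι (E i j))) (a : SymAlg m n) : P a := by
  have zero : P 0 := by simpa using smul 0 1 one
  have mulX : ∀ a X, P a → P (a * symι X) := by
    intro a X ha
    have eX : X = ∑ i, ∑ j, X i j • E i j := by
      conv_lhs => rw [Matrix.matrix_eq_sum_single X]
      simp [E, Matrix.smul_single]
    have sumP : ∀ {κ : Type} (s : Finset κ) (f : κ → SymAlg m n), (∀ i, P (f i)) →
        P (∑ i ∈ s, f i) := by
      intro κ s f hf
      exact Finset.sum_induction f P add zero (fun i _ => hf i)
    rw [eX]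
    simp only [map_sum, map_smul, Finset.mul_sum, mul_smul_comm]
    exact sumP _ _ fun i => sumP _ _ fun j => smul _ _ (mul _ _ _ ha)
  obtain ⟨t, rfl⟩ : ∃ t, symMk m n t = a := RingQuot.mkAlgHom_surjective ℂ (SymRel m n) a
  have : ∀ b, P b → P (b * symMk m n t) := by
    induction t using TensorAlgebra.induction with
    | algebraMap r =>
      intro b hb
      rw [AlgHom.commutes, ← Algebra.commutes, ← Algebra.smul_def]
      exact smul _ _ hb
    | ι X => exact fun b hb => mulX b X hb
    | mul x y hx hy =>
      intro b hb
      rw [map_mul, ← mul_assoc]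
      exact hy _ (hx _ hb)
    | add x y hx hy =>
      intro b hb
      rw [map_add, mul_add]
      exact add _ _ (hx _ hb) (hy _ hb)
  simpa using this 1 one

/-! ### The operation `A * X` on `S(gl(m,n))` and the map `σ̃ : U(gl(m,n)) → S(gl(m,n))` -/

/-- The linear map `Y ↦ (-1)^{p p(Y)} Y` (`Y` homogeneous) of `gl(m,n)`. -/
def twist (p : ZMod 2) : Gl m n →ₗ[ℂ] Gl m n where
  toFun Y := Matrix.of fun i j => sgn (p * (par i + par j)) * Y i j
  map_add' X Y := by ext i j; simp [mul_add]
  map_smul' c X := by ext i j; simp [mul_left_comm]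

lemma twist_of_isHom {p q : ZMod 2} {Y : Gl m n} (hY : IsHom q Y) :
    twist p Y = sgn (p * q) • Y := by
  ext i j
  by_cases h : Y i j = 0
  · simp [twist, h]
  · simp [twist, hY i j h]

/-- The linear map behind `derHom`. -/
def derGen (p : ZMod 2) (X : Gl m n) : Gl m n →ₗ[ℂ] Matrix (Fin 2) (Fin 2) (SymAlg m n) where
  toFun Y := !![symι Y, symι (Y * X); 0, symι (twist p Y)]
  map_add' Y Z := by ext i j; fin_cases i <;> fin_cases j <;> simp [add_mul]
  map_smul' c Y := by ext i j; fin_cases i <;> fin_cases j <;> simp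

/-- For `X` homogeneous of parity `p`, the algebra homomorphism
`A ↦ !![A, D A; 0, ε A]`, where `ε` is the automorphism `Y ↦ (-1)^{p p(Y)} Y` and `D` is the right
superderivation of parity `p` with `D Y = ⟨Y X⟩`, i.e. `D (A B) = A (D B) + (D A) (ε B)`. -/
def derHom {p : ZMod 2} {X : Gl m n} (hX : IsHom p X) :
    SymAlg m n →ₐ[ℂ] Matrix (Fin 2) (Fin 2) (SymAlg m n) :=
  symLift (derGen p X) (by
    intro y z Y Z hY hZ
    have h1 := symι_swap hY hZ
    have h2 := symι_swap hY (hZ.mul hX)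
    have h3 := symι_swap (hY.mul hX) hZ
    have s1 : sgn (y * (z + p)) = sgn (y * z) * sgn (p * y) := by
      rw [← sgn_add]; congr 1; ring
    have s2 : sgn (p * z) * sgn ((y + p) * z) = sgn (y * z) := by
      rw [show (y + p) * z = y * z + p * z by ring, sgn_add, mul_left_comm, sgn_mul_self, mul_one]
    simp only [derGen, LinearMap.coe_mk, AddHom.coe_mk, twist_of_isHom hY, twist_of_isHom hZ,
      map_smul]
    ext i j
    fin_cases i <;> fin_cases j
    · simp [h1]
    · simp only [Matrix.mul_fin_two, Matrix.smul_apply]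
      simp only [Fin.mk_zero, Fin.mk_one, Matrix.of_apply, Matrix.cons_val', Matrix.cons_val_zero,
        Matrix.cons_val_one, Matrix.cons_val_fin_one, Fin.isValue]
      rw [h2, mul_smul_comm, h3, smul_smul, s1, s2, mul_smul_comm, smul_add, smul_smul, add_comm]
    · simp
    · simp only [Matrix.mul_fin_two, Matrix.smul_apply]
      simp [h1, smul_smul]
      congr 1
      ring)

lemma derHom_symι {p : ZMod 2} {X : Gl m n} (hX : IsHom p X) (Y : Gl m n) :
    derHom hX (symι Y) = derGen p X Y := by
  exact symLift_symι _ _ _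

/-- The right superderivation `Y_1 ⋯ Y_k ↦ ∑ r, (-1)^{P(r)} Y_1 ⋯ ⟨Y_r X⟩ ⋯ Y_k` of `S(gl(m,n))`,
linear in `X` (for homogeneous `X` see `rder_mul`). -/
def rder (X : Gl m n) : SymAlg m n →ₗ[ℂ] SymAlg m n :=
  ∑ i, ∑ j, X i j • ((Matrix.entryLinearMap ℂ (SymAlg m n) 0 1) ∘ₗ
    (derHom (isHom_E i j)).toLinearMap)

/-- The operation `A * X` of the special symmetrization. -/
def star (X : Gl m n) : SymAlg m n →ₗ[ℂ] SymAlg m n :=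
  LinearMap.mulRight ℂ (symι X) + rder X

lemma rder_add (X Y : Gl m n) : rder (X + Y) = rder X + rder Y := by
  simp [rder, add_smul, Finset.sum_add_distrib]

lemma rder_smul (c : ℂ) (X : Gl m n) : rder (c • X) = c • rder X := by
  simp [rder, mul_smul, Finset.smul_sum]

lemma rder_one (X : Gl m n) : rder X 1 = 0 := by
  simp [rder]

lemma derHom_zero_zero {p : ZMod 2} {X : Gl m n} (hX : IsHom p X) (A : SymAlg m n) :
    derHom hX A 0 0 = A := by
  induction A using sym_induction with
  | one => simp
  | add a b ha hb => simp [ha, hb]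
  | smul c a ha => simp [ha]
  | mul a i j ha =>
    have h : derHom hX (symι (E i j)) = derGen p X (E i j) :=
      derHom_symι _ _
    rw [map_mul, Matrix.mul_apply, Fin.sum_univ_two, ha, h]
    simp [derGen]

lemma rder_mul {p q : ZMod 2} {X Y : Gl m n} (hX : IsHom p X) (hY : IsHom q Y)
    (A : SymAlg m n) :
    rder X (A * symι Y) = A * symι (Y * X) + sgn (p * q) • (rder X A * symι Y) := by
  have eX : X = ∑ i, ∑ j, X i j • E i j := by
    conv_lhs => rw [Matrix.matrix_eq_sum_single X]
    simp [E, Matrix.smul_single]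
  have key : ∀ i j, derHom (isHom_E i j) (A * symι Y) 0 1 = A * symι (Y * E i j) +
      sgn ((par i + par j) * q) • (derHom (isHom_E i j) A 0 1 * symι Y) := by
    intro i j
    have h := derHom_symι (isHom_E i j) Y
    rw [map_mul, Matrix.mul_apply, Fin.sum_univ_two, derHom_zero_zero, h]
    simp [derGen, twist_of_isHom hY]
  have e1 : A * symι (Y * X) = ∑ i, ∑ j, X i j • (A * symι (Y * E i j)) := by
    conv_lhs => rw [eX]
    simp only [Finset.mul_sum, map_sum, mul_smul_comm, map_smul]
  rw [e1]
  simp only [rder, LinearMap.sum_apply, LinearMap.smul_apply, LinearMap.comp_apply,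
    AlgHom.toLinearMap_apply, Matrix.entryLinearMap_apply, key, Finset.sum_mul, Finset.smul_sum,
    smul_mul_assoc]
  rw [← Finset.sum_add_distrib]
  refine Finset.sum_congr rfl fun i _ => ?_
  rw [← Finset.sum_add_distrib]
  refine Finset.sum_congr rfl fun j _ => ?_
  by_cases h : X i j = 0
  · simp [h]
  · have hs : sgn ((par i + par j) * q) = sgn (p * q) := by rw [hX i j h]
    simp only [hs]
    rw [smul_add, smul_comm (X i j)]

lemma rder_comm {x y : ZMod 2} {X Y : Gl m n} (hX : IsHom x X) (hY : IsHom y Y)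
    (A : SymAlg m n) :
    rder Y (rder X A) - rder (X * Y) A
      = sgn (x * y) • (rder X (rder Y A) - rder (Y * X) A) := by
  induction A using sym_induction with
  | one => simp [rder_one]
  | add a b ha hb =>
    simp only [map_add]
    rw [add_sub_add_comm, ha, hb, add_sub_add_comm, smul_add]
  | smul c a ha =>
    simp only [map_smul]
    rw [← smul_sub, ha, ← smul_sub, smul_comm]
  | mul a i j ha =>
    obtain ⟨z, hZ⟩ : ∃ z, IsHom z (E i j) := ⟨_, isHom_E i j⟩
    generalize E i j = Z at hZ
    have s1 : sgn ((x + y) * z) = sgn (x * z) * sgn (y * z) := by rw [← sgn_add, add_mul]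
    have s1' : sgn ((y + x) * z) = sgn (x * z) * sgn (y * z) := by rw [add_comm, s1]
    have s2 : sgn (y * (z + x)) = sgn (y * z) * sgn (x * y) := by
      rw [← sgn_add, mul_add, mul_comm x y]
    have s3 : sgn (x * (z + y)) = sgn (x * z) * sgn (x * y) := by
      rw [← sgn_add, mul_add]
    have ha' : rder Y (rder X a) = rder (X * Y) a
      + sgn (x * y) • (rder X (rder Y a) - rder (Y * X) a) := by rw [← ha]; abel
    rw [rder_mul hX hZ, rder_mul hY hZ, rder_mul (hX.mul hY) hZ, rder_mul (hY.mul hX) hZ]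
    simp only [map_add, map_smul]
    rw [rder_mul hY (hZ.mul hX), rder_mul hX (hZ.mul hY), rder_mul hX hZ, rder_mul hY hZ, ha',
      s1, s1', s2, s3]
    simp only [mul_assoc]
    have t := sgn_mul_self (x * y)
    simp only [add_mul, sub_mul, smul_add, smul_sub, smul_mul_assoc]
    match_scalars <;> first
      | ring1
      | linear_combination sgn (x * z) * t
      | linear_combination -sgn (x * z) * t

lemma star_one (X : Gl m n) : star X 1 = symι X := by
  simp [star, rder_one]

/-- The defining formula of `A * X` for `A = Y_1 ⋯ Y_k`. -/
lemma star_prod {k : ℕ} (Y : Fin k → Gl m n) (q : Fin k → ZMod 2) (hY : ∀ r, IsHom (q r) (Y r))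
    {p : ZMod 2} {X : Gl m n} (hX : IsHom p X) :
    star X (List.ofFn fun s => symι (Y s)).prod =
      (List.ofFn fun s => symι (Y s)).prod * symι X +
      ∑ r, sgn ((∑ s with r < s, q s) * p) •
        (List.ofFn fun s => symι (if s = r then Y r * X else Y s)).prod := by
  simp only [star, LinearMap.add_apply, LinearMap.mulRight_apply, add_right_inj]
  induction k with
  | zero => simp [rder_one]
  | succ k ih =>
    have h := ih (fun s => Y s.castSucc) (fun s => q s.castSucc) (fun s => hY s.castSucc)
    have e1 : ∀ f : Fin (k + 1) → SymAlg m n,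
        (List.ofFn f).prod = (List.ofFn fun s : Fin k => f s.castSucc).prod * f (Fin.last k) := by
      intro f
      rw [List.ofFn_succ', List.concat_eq_append, List.prod_append, List.prod_singleton]
    simp only [e1]
    rw [rder_mul hX (hY (Fin.last k)), h, Fin.sum_univ_castSucc, add_comm]
    congr 1
    · rw [Finset.sum_mul, Finset.smul_sum]
      refine Finset.sum_congr rfl fun r _ => ?_
      have hs : ∑ s with r.castSucc < s, q s = ∑ s with r < s, q s.castSucc + q (Fin.last k) := by
        simp only [Finset.sum_filter, Fin.sum_univ_castSucc, Fin.castSucc_lt_castSucc_iff,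
          Fin.castSucc_lt_last, if_true]
      simp only [hs, Fin.castSucc_inj, (Fin.castSucc_lt_last r).ne', if_false]
      rw [add_mul, sgn_add, smul_mul_assoc, smul_smul, mul_comm (sgn _), mul_comm p]
    · have hs : (Finset.univ.filter fun s => Fin.last k < s) = ∅ := by
        ext s; simp [Fin.le_last]
      have hn : ∀ s : Fin k, s.castSucc ≠ Fin.last k := fun s => (Fin.castSucc_lt_last s).ne
      simp [hs, hn, sgn]

lemma star_comm {x y : ZMod 2} {X Y : Gl m n} (hX : IsHom x X) (hY : IsHom y Y)
    (A : SymAlg m n) :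
    star Y (star X A) - star (X * Y) A
      = sgn (x * y) • (star X (star Y A) - star (Y * X) A) := by
  have h := rder_comm hX hY A
  have h' : rder Y (rder X A) = rder (X * Y) A
      + sgn (x * y) • (rder X (rder Y A) - rder (Y * X) A) := by rw [← h]; abel
  have t := sgn_mul_self (x * y)
  simp only [star, LinearMap.add_apply, LinearMap.mulRight_apply, map_add, rder_mul hX hY,
    rder_mul hY hX, h', mul_assoc, symι_swap hX hY, mul_comm y x, mul_smul_comm]
  match_scalars <;> first
    | ring1
    | linear_combination t
    | linear_combination -t

/-- Right multiplication `A ↦ A * X`, with values in the opposite algebra, so that products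
`X_1 X_2 ⋯` act as `A ↦ (⋯((A * X_1) * X_2)⋯)`. -/
def starOp : Gl m n →ₗ[ℂ] (Module.End ℂ (SymAlg m n))ᵐᵒᵖ where
  toFun X := MulOpposite.op (star X)
  map_add' X Y := by
    rw [← MulOpposite.op_add]
    congr 1
    ext A
    simp only [star, rder_add, map_add, LinearMap.add_apply, LinearMap.mulRight_apply, mul_add]
    abel
  map_smul' c X := by
    rw [RingHom.id_apply, ← MulOpposite.op_smul]
    congr 1
    ext A
    simp only [star, rder_smul, map_smul, LinearMap.add_apply, LinearMap.smul_apply,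
      LinearMap.mulRight_apply, mul_smul_comm, smul_add]

/-- The right action of `U(gl(m,n))` on `S(gl(m,n))` that extends `A ↦ A * X`. -/
def starHom : EnvAlg m n →ₐ[ℂ] (Module.End ℂ (SymAlg m n))ᵐᵒᵖ :=
  envLift starOp (by
    intro x y X Y hX hY
    apply MulOpposite.unop_injective
    ext A
    have h := star_comm hX hY A
    have e : starOp (X * Y - sgn (x * y) • (Y * X)) =
        starOp (X * Y) - sgn (x * y) • starOp (Y * X) := by rw [map_sub, map_smul]
    rw [e]
    simp only [starOp, LinearMap.coe_mk, AddHom.coe_mk, MulOpposite.unop_sub, MulOpposite.unop_mul,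
      MulOpposite.unop_smul, MulOpposite.unop_op, LinearMap.sub_apply, LinearMap.smul_apply,
      Module.End.mul_apply]
    rw [smul_sub, sub_eq_sub_iff_add_eq_add] at h
    rw [sub_eq_sub_iff_add_eq_add, ← sub_eq_zero]
    rw [← sub_eq_zero] at h
    rw [← h]
    abel)

/-- The map `σ̃ : U(gl(m,n)) → S(gl(m,n))`,
`X_1 X_2 ⋯ X_k ↦ (⋯(X_1 * X_2) * ⋯) * X_k`. -/
def sigmaTilde : EnvAlg m n →ₗ[ℂ] SymAlg m n where
  toFun u := (starHom u).unop 1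
  map_add' u v := by simp
  map_smul' c u := by simp

lemma sigmaTilde_one : sigmaTilde (1 : EnvAlg m n) = 1 := by
  simp [sigmaTilde]

lemma sigmaTilde_mul (u : EnvAlg m n) (X : Gl m n) :
    sigmaTilde (u * envι X) = star X (sigmaTilde u) := by
  have h : starHom (envι X) = starOp X := envLift_envι _ _ _
  simp [sigmaTilde, h, starOp]

/-! ### The tensor space and the action of `U(gl(m,n))` -/

/-- The tensor space `(ℂ^{m|n})^{⊗ N}`. -/
abbrev TensorSpace (m n N : ℕ) : Type := ⨂[ℂ] _ : Fin N, (Idx m n → ℂ)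

/-- The basis `e_{j_1} ⊗ ⋯ ⊗ e_{j_N}` of the tensor space. -/
def tensorBasis (m n N : ℕ) : Module.Basis (Fin N → Idx m n) ℂ (TensorSpace m n N) :=
  Basis.piTensorProduct fun _ => Pi.basisFun ℂ (Idx m n)

/-- The operator `v ↦ (-1)^{d p(v)} v` (`v` homogeneous) on `ℂ^{m|n}`. -/
def parOp (m n : ℕ) (d : ZMod 2) : (Idx m n → ℂ) →ₗ[ℂ] (Idx m n → ℂ) :=
  Matrix.toLin' (Matrix.diagonal fun i => sgn (d * par i))

/-- For `X` of parity `d`, the operator on the tensor space given by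
`v_1 ⊗ ⋯ ⊗ v_N ↦ (-1)^{d (p(v_1) + ⋯ + p(v_{t-1}))} v_1 ⊗ ⋯ ⊗ X v_t ⊗ ⋯ ⊗ v_N`. -/
def placeOp (N : ℕ) (d : ZMod 2) (t : Fin N) : Gl m n →ₗ[ℂ] Module.End ℂ (TensorSpace m n N) :=
  ((PiTensorProduct.mapMultilinear ℂ (fun _ : Fin N => Idx m n → ℂ)
    (fun _ : Fin N => Idx m n → ℂ)).toLinearMap
      (fun q => if q < t then parOp m n d else LinearMap.id) t) ∘ₗ
    (Matrix.toLin' : Gl m n ≃ₗ[ℂ] _).toLinearMap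

/-- The action of `gl(m,n)` on the `N`-th tensor power of the vector representation. -/
def tensorGen (N : ℕ) : Gl m n →ₗ[ℂ] Module.End ℂ (TensorSpace m n N) :=
  ∑ t, ∑ d, placeOp N d t ∘ₗ homPart d

lemma tensorGen_of_isHom {N : ℕ} {p : ZMod 2} {X : Gl m n} (hX : IsHom p X) :
    tensorGen N X = ∑ t, placeOp N p t X := by
  simp only [tensorGen, LinearMap.sum_apply, LinearMap.comp_apply, homPart_of_isHom hX]
  refine Finset.sum_congr rfl fun t _ => ?_
  rw [Finset.sum_eq_single p]
  · simp
  · intro d _ hd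
    simp [hd]
  · simp

/-- The tensor factors of `placeOp`. -/
def slot {N : ℕ} (d : ZMod 2) (t : Fin N) (X : Gl m n) (q : Fin N) :
    (Idx m n → ℂ) →ₗ[ℂ] (Idx m n → ℂ) :=
  if q < t then parOp m n d else if q = t then Matrix.toLin' X else LinearMap.id

lemma placeOp_eq {N : ℕ} (d : ZMod 2) (t : Fin N) (X : Gl m n) :
    placeOp N d t X = PiTensorProduct.map (slot d t X) := by
  have : slot d t X = Function.update
      (fun q => if q < t then parOp m n d else LinearMap.id) t (Matrix.toLin' X) := by
    ext1 q
    by_cases h : q = t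
    · subst h; simp [slot]
    · simp [slot, h]
  rw [this]
  rfl

lemma parOp_mul (d e : ZMod 2) : parOp m n d * parOp m n e = parOp m n (d + e) := by
  rw [parOp, parOp, parOp, Module.End.mul_eq_comp, ← Matrix.toLin'_mul, Matrix.diagonal_mul_diagonal]
  simp only [add_mul, sgn_add]

lemma parOp_comm {q : ZMod 2} {Y : Gl m n} (hY : IsHom q Y) (d : ZMod 2) :
    parOp m n d * Matrix.toLin' Y = sgn (d * q) • (Matrix.toLin' Y * parOp m n d) := by
  rw [parOp, Module.End.mul_eq_comp, Module.End.mul_eq_comp, ← Matrix.toLin'_mul,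
    ← Matrix.toLin'_mul, ← map_smul]
  congr 1
  ext i j
  rw [Matrix.smul_apply, Matrix.diagonal_mul, Matrix.mul_diagonal]
  by_cases h : Y i j = 0
  · simp [h]
  · have e : sgn (d * q) * sgn (d * par j) = sgn (d * par i) := by
      rw [← hY i j h, ← sgn_add]
      congr 1
      linear_combination d * (CharTwo.add_self_eq_zero (par j))
    rw [smul_eq_mul, ← e]
    ring

lemma placeOp_mul_same {N : ℕ} (p q : ZMod 2) (t : Fin N) (X Y : Gl m n) :
    placeOp N p t X * placeOp N q t Y = placeOp N (p + q) t (X * Y) := by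
  rw [placeOp_eq, placeOp_eq, placeOp_eq, ← PiTensorProduct.map_mul]
  congr 1
  ext1 r
  rcases lt_trichotomy r t with h | h | h
  · simp [slot, h, parOp_mul]
  · simp [slot, h, Module.End.mul_eq_comp, Matrix.toLin'_mul]
  · simp [slot, h.not_gt, h.ne', Module.End.mul_eq_comp]

lemma placeOp_mul_lt {N : ℕ} {p q : ZMod 2} {X Y : Gl m n} (hY : IsHom q Y)
    {s t : Fin N} (hst : s < t) :
    placeOp N p t X * placeOp N q s Y = sgn (p * q) • (placeOp N q s Y * placeOp N p t X) := by
  rw [placeOp_eq, placeOp_eq, ← PiTensorProduct.map_mul, ← PiTensorProduct.map_mul]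
  have e : (fun i => slot p t X i * slot q s Y i) = Function.update
      (fun i => slot q s Y i * slot p t X i) s
        (sgn (p * q) • (slot q s Y s * slot p t X s)) := by
    ext1 r
    by_cases h : r = s
    · subst h
      simp [slot, hst, parOp_comm hY]
    · rw [Function.update_of_ne h]
      rcases lt_or_gt_of_ne h with h' | h'
      · simp [slot, h', h'.trans hst, parOp_mul, add_comm]
      · simp [slot, h, h'.not_gt, Module.End.mul_eq_comp]
  rw [e, PiTensorProduct.map_update_smul, Function.update_eq_self]

lemma placeOp_swap {N : ℕ} {p q : ZMod 2} {X Y : Gl m n} (hX : IsHom p X) (hY : IsHom q Y)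
    {s t : Fin N} (hst : t ≠ s) :
    placeOp N p t X * placeOp N q s Y = sgn (p * q) • (placeOp N q s Y * placeOp N p t X) := by
  rcases lt_or_gt_of_ne hst with h | h
  · rw [placeOp_mul_lt hX h, smul_smul, mul_comm q p, sgn_mul_self, one_smul]
  · exact placeOp_mul_lt hY h

lemma tensorGen_bracket (N : ℕ) {p q : ZMod 2} {X Y : Gl m n} (hX : IsHom p X)
    (hY : IsHom q Y) :
    tensorGen N X * tensorGen N Y - sgn (p * q) • (tensorGen N Y * tensorGen N X)
      = tensorGen N (X * Y - sgn (p * q) • (Y * X)) := by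
  have key : tensorGen N X * tensorGen N Y + sgn (p * q) • tensorGen N (Y * X)
      = tensorGen N (X * Y) + sgn (p * q) • (tensorGen N Y * tensorGen N X) := by
    rw [tensorGen_of_isHom hX, tensorGen_of_isHom hY, tensorGen_of_isHom (hX.mul hY),
      tensorGen_of_isHom (hY.mul hX), Finset.sum_mul_sum, Finset.sum_mul_sum,
      Finset.sum_comm (f := fun i j => placeOp N q i Y * placeOp N p j X)]
    simp only [Finset.smul_sum]
    rw [← Finset.sum_add_distrib, ← Finset.sum_add_distrib]
    refine Finset.sum_congr rfl fun s _ => ?_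
    rw [← Finset.add_sum_erase _ _ (Finset.mem_univ s),
      ← Finset.add_sum_erase (a := s) _ (fun t => sgn (p * q) •
        (placeOp N q t Y * placeOp N p s X)) (Finset.mem_univ s), placeOp_mul_same,
      placeOp_mul_same, Finset.sum_congr rfl fun t ht =>
        placeOp_swap hX hY (Finset.ne_of_mem_erase ht).symm]
    abel
  have e : tensorGen N (X * Y - sgn (p * q) • (Y * X))
      = tensorGen N (X * Y) - sgn (p * q) • tensorGen N (Y * X) := by
    rw [map_sub, map_smul]
  rw [e]
  refine (sub_eq_sub_iff_add_eq_add (G := Module.End ℂ (TensorSpace m n N))).mpr ?_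
  exact key

/-- The action of `U(gl(m,n))` on the tensor space: the `N`-th tensor power of the vector
representation. -/
def envAction (m n N : ℕ) : EnvAlg m n →ₐ[ℂ] Module.End ℂ (TensorSpace m n N) :=
  envLift (B := Module.End ℂ (TensorSpace m n N)) (tensorGen N)
    fun _ _ _ _ hX hY => tensorGen_bracket N hX hY

/-! ### The action of `S(gl(m,n))` on the tensor space -/

/-- A node of the tree of subscripts: the set of places that have been changed so far, and the
current sequence of subscripts `(k_1, …, k_N)`. -/
abbrev TreeNode (m n N : ℕ) : Type := Finset (Fin N) × (Fin N → Idx m n)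

/-- One step of the tree for the factor `E_{ab}`, on formal linear combinations of nodes. A node
generates one node for every place `t` with `k_t = b` that has not been changed before: `k_t`
becomes `a`, the place `t` counts as changed (also if `a = b`), and the coefficient is
multiplied by `(-1)^{(p(k_1) + ⋯ + p(k_{t-1})) p(E_{ab})}`. -/
def treeStep {N : ℕ} (a b : Idx m n) :
    (TreeNode m n N →₀ ℂ) →ₗ[ℂ] (TreeNode m n N →₀ ℂ) :=
  Finsupp.linearCombination ℂ fun v =>
    ∑ t with t ∉ v.1 ∧ v.2 t = b,
      Finsupp.single (insert t v.1, Function.update v.2 t a)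
        (sgn ((∑ q with q < t, par (v.2 q)) * (par a + par b)))

/-- The linear extension of `E_{ab} ↦ treeStep a b` to `gl(m,n)`. -/
def treeGen (N : ℕ) : Gl m n →ₗ[ℂ] Module.End ℂ (TreeNode m n N →₀ ℂ) where
  toFun X := ∑ a, ∑ b, X a b • treeStep a b
  map_add' X Y := by simp [add_smul, Finset.sum_add_distrib]
  map_smul' c X := by simp [mul_smul, Finset.smul_sum]

lemma treeGen_E {N : ℕ} (a b : Idx m n) : treeGen N (E a b) = treeStep a b := by
  simp only [treeGen, LinearMap.coe_mk, AddHom.coe_mk]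
  rw [Finset.sum_eq_single a, Finset.sum_eq_single b]
  · simp
  · intro j _ hj
    simp [hj.symm]
  · simp
  · intro i _ hi
    simp [hi.symm]
  · simp

lemma sum_par_update {N : ℕ} (k : Fin N → Idx m n) (s t : Fin N) (c : Idx m n) :
    ∑ q with q < t, par (Function.update k s c q) =
      ∑ q with q < t, par (k q) + if s < t then par c + par (k s) else 0 := by
  have h : ∀ q, par (Function.update k s c q) =
      par (k q) + if q = s then par c + par (k s) else 0 := by
    intro q
    by_cases hq : q = s
    · subst hq
      simp only [Function.update_self, if_true]
      linear_combination -(CharTwo.add_self_eq_zero (par (k q)))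
    · simp [hq]
  simp only [h, Finset.sum_add_distrib, Finset.sum_ite_eq', Finset.mem_filter, Finset.mem_univ,
    true_and]

lemma treeStep_swap {N : ℕ} (a b c d : Idx m n) :
    treeStep (N := N) a b * treeStep c d =
      sgn ((par a + par b) * (par c + par d)) • (treeStep c d * treeStep a b) := by
  refine Finsupp.lhom_ext' fun v => LinearMap.ext_ring ?_
  obtain ⟨S, k⟩ := v
  have step : ∀ (a b : Idx m n) (S : Finset (Fin N)) (k : Fin N → Idx m n) (z : ℂ),
      treeStep a b (Finsupp.single (S, k) z) = ∑ t, if t ∉ S ∧ k t = b then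
        Finsupp.single (insert t S, Function.update k t a)
          (z * sgn ((∑ q with q < t, par (k q)) * (par a + par b))) else 0 := by
    intro a b S k z
    rw [treeStep, Finsupp.linearCombination_single, Finset.sum_filter, Finset.smul_sum]
    refine Finset.sum_congr rfl fun t _ => ?_
    split_ifs <;> simp
  have step2 : ∀ a b c d : Idx m n, treeStep (N := N) a b (treeStep c d (Finsupp.single (S, k) 1)) =
      ∑ s, ∑ t, if (s ∉ S ∧ k s = d) ∧ t ∉ insert s S ∧ Function.update k s c t = b then
        Finsupp.single (insert t (insert s S), Function.update (Function.update k s c) t a)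
          (sgn ((∑ q with q < s, par (k q)) * (par c + par d)
            + (∑ q with q < t, par (Function.update k s c q)) * (par a + par b))) else 0 := by
    intro a b c d
    rw [step, map_sum]
    refine Finset.sum_congr rfl fun s _ => ?_
    by_cases h : s ∉ S ∧ k s = d
    · simp only [h, step, one_mul, sgn_add, not_false_eq_true, and_self, true_and, if_true]
    · simp only [h, if_false, map_zero, false_and, Finset.sum_const_zero]
  change treeStep a b (treeStep c d (Finsupp.single (S, k) 1)) =
    sgn _ • treeStep c d (treeStep a b (Finsupp.single (S, k) 1))
  rw [step2, step2, Finset.sum_comm]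
  simp only [Finset.smul_sum]
  refine Finset.sum_congr rfl fun t _ => Finset.sum_congr rfl fun s _ => ?_
  by_cases hst : s = t
  · subst hst
    simp
  have hts : t ≠ s := fun h => hst h.symm
  rw [Function.update_of_ne hts, Function.update_of_ne hst]
  by_cases hc : (s ∉ S ∧ k s = d) ∧ t ∉ S ∧ k t = b
  · obtain ⟨⟨h1, h2⟩, h3, h4⟩ := hc
    rw [if_pos (by simp [h1, h2, h3, h4, hts]), if_pos (by simp [h1, h2, h3, h4, hst]),
      Finsupp.smul_single, Finset.insert_comm, Function.update_comm hst, smul_eq_mul, ← sgn_add,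
      sum_par_update, sum_par_update, h2, h4]
    congr 2
    have two : (2 : ZMod 2) = 0 := rfl
    rcases lt_or_gt_of_ne hst with h | h
    · rw [if_pos h, if_neg h.not_gt]
      ring
    · rw [if_pos h, if_neg h.not_gt]
      linear_combination -((par a + par b) * (par c + par d)) * two
  · rw [if_neg, if_neg, smul_zero]
    · simp only [Finset.mem_insert, not_or]
      tauto
    · simp only [Finset.mem_insert, not_or]
      tauto

/-- The tree rule, as an action of `S(gl(m,n))` on formal linear combinations of nodes. The
factors of a monomial are applied from right to left. -/
def treeHom (m n N : ℕ) : SymAlg m n →ₐ[ℂ] Module.End ℂ (TreeNode m n N →₀ ℂ) :=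
  symLift (B := Module.End ℂ (TreeNode m n N →₀ ℂ)) (treeGen N) fun _ _ X Y hX hY => by
    have h := swap_of_units (B := Module.End ℂ (TreeNode m n N →₀ ℂ)) ((LinearMap.mul ℂ (Module.End ℂ (TreeNode m n N →₀ ℂ))).compl₁₂
      (treeGen N) (treeGen N)) (fun i j k l => by
        simp only [LinearMap.compl₁₂_apply, LinearMap.mul_apply', treeGen_E]
        exact treeStep_swap i j k l) hX hY
    exact h

lemma treeHom_E {N : ℕ} (a b : Idx m n) : treeHom m n N (symι (E a b)) = treeStep a b :=
  (symLift_symι (B := Module.End ℂ (TreeNode m n N →₀ ℂ)) _ _ _).trans (treeGen_E a b)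

/-- The action of `S(gl(m,n))` on the tensor space: `a (e_{j_1} ⊗ ⋯ ⊗ e_{j_N})` is obtained from
the last level of the tree with root `(j_1, …, j_N)` by replacing every node `(k_1, …, k_N)` by
`e_{k_1} ⊗ ⋯ ⊗ e_{k_N}`. -/
def symAction (m n N : ℕ) : SymAlg m n →ₗ[ℂ] Module.End ℂ (TensorSpace m n N) :=
  ((tensorBasis m n N).constr ℂ).toLinearMap ∘ₗ LinearMap.pi fun j =>
    Finsupp.linearCombination ℂ (fun v : TreeNode m n N => tensorBasis m n N v.2) ∘ₗ
      (LinearMap.applyₗ (Finsupp.single (∅, j) 1)) ∘ₗ (treeHom m n N).toLinearMap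

end SuperGL

end

noncomputable section

namespace SuperGL

variable {m n : ℕ}

/-! ### The length filtrations and the bijectivity of `σ̃` -/

/-! Bijectivity is a triangularity argument. `A * X` is right multiplication by `X` plus the
superderivation `rder X`, which does not raise degree (`rder_mem_symFil`). Hence on a tensor of
degree at most `k + 1` the map `σ̃` agrees with the projection to `S(gl(m,n))` up to degree `k`
(`sigmaTilde_envMk_sub_mem`), and surjectivity follows by induction on degree. Injectivity does not
presuppose the PBW theorem. The defining relations of `S(gl(m,n))` hold in the associated graded
algebra of `U(gl(m,n))`, because a supercommutator of two generators has degree one; so the symbol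
of a tensor determines its image in `U(gl(m,n))` up to lower degree (`lowerOrder_of_symMk_eq`). An
element of the kernel of `σ̃` therefore drops in degree again and again
(`mem_envFil_of_sigmaTilde_mem`) until it is a scalar, and `σ̃` fixes scalars.

For the actions it suffices that `a * X` acts as `X` followed by `a` (`symAction_star`); induction
along words then gives the claim. Let `X = E_{cd}` act at a place of a basis tensor, then grow the
tree of `a`. Either no factor of `a` touches that place, which is the contribution of the monomial
`a X`, or exactly one factor `Y_r` does, since a place changes at most once, which is the
contribution of `⟨Y_r X⟩`. To carry the signs, `unmarkedStep` lets `X` act without marking its place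
and is moved past the factors of `a` one at a time (`treeStep_mul_unmarkedStep`,
`nodeTensor_treeHom_unmarkedStep`). -/

lemma isHom_homPart (p : ZMod 2) (X : Gl m n) : IsHom p (homPart p X) := by
  intro i j h
  by_contra hp
  exact h (by simp [homPart, hp])

lemma homPart_zero_add_homPart_one (X : Gl m n) : homPart 0 X + homPart 1 X = X := by
  ext i j
  have h : ∀ a : ZMod 2, a = 0 ∨ a = 1 := by decide
  rcases h (par i + par j) with h | h <;> simp [homPart, h]

/-- The tensors of degree at most `k`. -/
def tenFil (m n k : ℕ) : Submodule ℂ (TensorAlgebra ℂ (Gl m n)) :=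
  (1 ⊔ LinearMap.range (TensorAlgebra.ι ℂ)) ^ k

/-- The elements of `S(gl(m,n))` of degree at most `k`. -/
def symFil (m n k : ℕ) : Submodule ℂ (SymAlg m n) :=
  (tenFil m n k).map (symMk m n).toLinearMap

/-- The elements of `U(gl(m,n))` of degree at most `k`. -/
def envFil (m n k : ℕ) : Submodule ℂ (EnvAlg m n) :=
  (tenFil m n k).map (envMk m n).toLinearMap

lemma tenFil_mono {k l : ℕ} (h : k ≤ l) : tenFil m n k ≤ tenFil m n l :=
  pow_le_pow_right₀ le_sup_left h

lemma envFil_mono {k l : ℕ} (h : k ≤ l) : envFil m n k ≤ envFil m n l :=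
  Submodule.map_mono (tenFil_mono h)

lemma symFil_mono {k l : ℕ} (h : k ≤ l) : symFil m n k ≤ symFil m n l :=
  Submodule.map_mono (tenFil_mono h)

lemma ι_mem_tenFil (X : Gl m n) : TensorAlgebra.ι ℂ X ∈ tenFil m n 1 := by
  rw [tenFil, pow_one]
  exact Submodule.mem_sup_right ⟨X, rfl⟩

lemma tenFil_mul_mem {k l : ℕ} {x y : TensorAlgebra ℂ (Gl m n)} (hx : x ∈ tenFil m n k)
    (hy : y ∈ tenFil m n l) : x * y ∈ tenFil m n (k + l) := by
  rw [tenFil, pow_add]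
  exact Submodule.mul_mem_mul hx hy

lemma envFil_mul_mem {k l : ℕ} {u v : EnvAlg m n} (hu : u ∈ envFil m n k)
    (hv : v ∈ envFil m n l) : u * v ∈ envFil m n (k + l) := by
  obtain ⟨x, hx, rfl⟩ := hu
  obtain ⟨y, hy, rfl⟩ := hv
  exact ⟨x * y, tenFil_mul_mem hx hy, map_mul (envMk m n) _ _⟩

lemma envι_mem_envFil (X : Gl m n) : envι X ∈ envFil m n 1 :=
  ⟨_, ι_mem_tenFil X, rfl⟩

lemma symFil_mul_symι_mem {k : ℕ} {a : SymAlg m n} (ha : a ∈ symFil m n k) (X : Gl m n) :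
    a * symι X ∈ symFil m n (k + 1) := by
  obtain ⟨x, hx, rfl⟩ := ha
  exact ⟨x * TensorAlgebra.ι ℂ X, tenFil_mul_mem hx (ι_mem_tenFil X), map_mul (symMk m n) _ _⟩

lemma tenFil_zero_le {p : Submodule ℂ (TensorAlgebra ℂ (Gl m n))} (h : 1 ∈ p) :
    tenFil m n 0 ≤ p := by
  rw [tenFil, pow_zero]
  exact Submodule.one_le.mpr h

/-- The induction principle for the filtration: degree at most `k + 1` is spanned by degree at most
`k` and its right multiples by generators. Below it is applied with `p` the preimage, kernel or
equalizer that encodes the desired property. -/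
lemma tenFil_succ_le {k : ℕ} {p : Submodule ℂ (TensorAlgebra ℂ (Gl m n))}
    (h : tenFil m n k ≤ p)
    (hmul : ∀ x ∈ tenFil m n k, ∀ X, x * TensorAlgebra.ι ℂ X ∈ p) : tenFil m n (k + 1) ≤ p := by
  rw [tenFil, pow_succ, Submodule.mul_sup, mul_one]
  refine sup_le h (Submodule.mul_le.mpr ?_)
  rintro x hx _ ⟨X, rfl⟩
  exact hmul x hx X

lemma exists_mem_tenFil (x : TensorAlgebra ℂ (Gl m n)) : ∃ k, x ∈ tenFil m n k := by
  induction x using TensorAlgebra.induction with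
  | algebraMap r =>
    exact ⟨0, by rw [tenFil, pow_zero]; exact Submodule.algebraMap_mem r⟩
  | ι X => exact ⟨1, ι_mem_tenFil X⟩
  | mul x y hx hy =>
    obtain ⟨k, hk⟩ := hx
    obtain ⟨l, hl⟩ := hy
    exact ⟨k + l, tenFil_mul_mem hk hl⟩
  | add x y hx hy =>
    obtain ⟨k, hk⟩ := hx
    obtain ⟨l, hl⟩ := hy
    exact ⟨max k l, add_mem (tenFil_mono (le_max_left k l) hk)
      (tenFil_mono (le_max_right k l) hl)⟩

lemma symMk_surjective : Function.Surjective (symMk m n) :=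
  RingQuot.mkAlgHom_surjective ℂ (SymRel m n)

lemma envMk_surjective : Function.Surjective (envMk m n) :=
  RingQuot.mkAlgHom_surjective ℂ (EnvRel m n)

/-! ### Degree estimates for `rder`, `A * X` and `σ̃`; surjectivity -/

lemma rder_mul_mem {k : ℕ} {a : SymAlg m n} (ha : a ∈ symFil m n k)
    (hd : ∀ X, rder X a ∈ symFil m n k) (X Y : Gl m n) :
    rder X (a * symι Y) ∈ symFil m n (k + 1) := by
  -- The signed Leibniz rule is available only for homogeneous arguments, so both matrices are split
  -- into even and odd parts.
  have key : ∀ p q, rder (homPart p X) (a * symι (homPart q Y)) ∈ symFil m n (k + 1) := by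
    intro p q
    rw [rder_mul (isHom_homPart p X) (isHom_homPart q Y)]
    exact add_mem (symFil_mul_symι_mem ha _)
      (Submodule.smul_mem _ _ (symFil_mul_symι_mem (hd _) _))
  rw [← homPart_zero_add_homPart_one X, ← homPart_zero_add_homPart_one Y, rder_add, map_add,
    mul_add, map_add, LinearMap.add_apply, LinearMap.add_apply]
  exact add_mem (add_mem (key 0 0) (key 1 0)) (add_mem (key 0 1) (key 1 1))

/-- A superderivation replaces one factor `Y_r` by the single factor `⟨Y_r X⟩`, so the number of
factors is unchanged. -/
lemma rder_mem_symFil {k : ℕ} (X : Gl m n) {a : SymAlg m n} (ha : a ∈ symFil m n k) :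
    rder X a ∈ symFil m n k := by
  obtain ⟨x, hx, rfl⟩ := ha
  induction k generalizing X x with
  | zero =>
    refine tenFil_zero_le (p := (symFil m n 0).comap (rder X ∘ₗ (symMk m n).toLinearMap)) ?_ hx
    simp [rder_one]
  | succ k ih =>
    refine tenFil_succ_le
      (p := (symFil m n (k + 1)).comap (rder X ∘ₗ (symMk m n).toLinearMap)) ?_ ?_ hx
    · exact fun y hy => symFil_mono k.le_succ (ih X y hy)
    · intro y hy Y
      have h := rder_mul_mem (a := symMk m n y) ⟨y, hy, rfl⟩ (fun X => ih X y hy) X Y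
      simpa [symι] using h

lemma star_mem_symFil {k : ℕ} (X : Gl m n) {a : SymAlg m n} (ha : a ∈ symFil m n k) :
    star X a ∈ symFil m n (k + 1) :=
  add_mem (symFil_mul_symι_mem ha X) (symFil_mono k.le_succ (rder_mem_symFil X ha))

lemma sigmaTilde_envMk_mul_ι (x : TensorAlgebra ℂ (Gl m n)) (X : Gl m n) :
    sigmaTilde (envMk m n (x * TensorAlgebra.ι ℂ X)) = star X (sigmaTilde (envMk m n x)) := by
  rw [map_mul]
  exact sigmaTilde_mul _ _

lemma sigmaTilde_envMk_mem {k : ℕ} {x : TensorAlgebra ℂ (Gl m n)} (hx : x ∈ tenFil m n k) :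
    sigmaTilde (envMk m n x) ∈ symFil m n k := by
  induction k generalizing x with
  | zero =>
    refine tenFil_zero_le
      (p := (symFil m n 0).comap (sigmaTilde ∘ₗ (envMk m n).toLinearMap)) ?_ hx
    have one : (1 : SymAlg m n) ∈ symFil m n 0 := ⟨1, by simp [tenFil], by simp⟩
    simpa [sigmaTilde_one] using one
  | succ k ih =>
    refine tenFil_succ_le
      (p := (symFil m n (k + 1)).comap (sigmaTilde ∘ₗ (envMk m n).toLinearMap)) ?_ ?_ hx
    · exact fun y hy => symFil_mono k.le_succ (ih hy)
    · intro y hy Y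
      change sigmaTilde (envMk m n (y * _)) ∈ symFil m n (k + 1)
      rw [sigmaTilde_envMk_mul_ι]
      exact star_mem_symFil Y (ih hy)

lemma sigmaTilde_envMk_of_mem_zero {x : TensorAlgebra ℂ (Gl m n)} (hx : x ∈ tenFil m n 0) :
    sigmaTilde (envMk m n x) = symMk m n x := by
  refine tenFil_zero_le (p := LinearMap.eqLocus (sigmaTilde ∘ₗ (envMk m n).toLinearMap)
    (symMk m n).toLinearMap) ?_ hx
  change sigmaTilde (envMk m n 1) = symMk m n 1
  rw [map_one (envMk m n), sigmaTilde_one, map_one]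

/-- `σ̃` preserves leading terms. -/
lemma sigmaTilde_envMk_sub_mem {k : ℕ} {x : TensorAlgebra ℂ (Gl m n)}
    (hx : x ∈ tenFil m n (k + 1)) :
    sigmaTilde (envMk m n x) - symMk m n x ∈ symFil m n k := by
  induction k generalizing x with
  | zero =>
    refine tenFil_succ_le (p := (symFil m n 0).comap
      (sigmaTilde ∘ₗ (envMk m n).toLinearMap - (symMk m n).toLinearMap)) ?_ ?_ hx
    · intro y hy
      change sigmaTilde (envMk m n y) - symMk m n y ∈ symFil m n 0
      rw [sigmaTilde_envMk_of_mem_zero hy, sub_self]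
      exact zero_mem _
    · intro y hy Y
      change sigmaTilde (envMk m n (y * _)) - symMk m n (y * _) ∈ symFil m n 0
      rw [sigmaTilde_envMk_mul_ι, sigmaTilde_envMk_of_mem_zero hy, map_mul]
      have : star Y (symMk m n y) - symMk m n y * symMk m n (TensorAlgebra.ι ℂ Y)
          = rder Y (symMk m n y) := add_sub_cancel_left _ _
      rw [this]
      exact rder_mem_symFil Y ⟨y, hy, rfl⟩
  | succ k ih =>
    refine tenFil_succ_le (p := (symFil m n (k + 1)).comap
      (sigmaTilde ∘ₗ (envMk m n).toLinearMap - (symMk m n).toLinearMap)) ?_ ?_ hx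
    · exact fun y hy => symFil_mono k.le_succ (ih hy)
    · intro y hy Y
      change sigmaTilde (envMk m n (y * _)) - symMk m n (y * _) ∈ symFil m n (k + 1)
      rw [sigmaTilde_envMk_mul_ι, map_mul]
      -- The error for `y Y` is the old error times `Y`, plus a derivation term; both have degree at
      -- most `k + 1`.
      have : star Y (sigmaTilde (envMk m n y)) - symMk m n y * symMk m n (TensorAlgebra.ι ℂ Y)
          = (sigmaTilde (envMk m n y) - symMk m n y) * symι Y
            + rder Y (sigmaTilde (envMk m n y)) := by
        simp only [star, symι, LinearMap.add_apply, LinearMap.mulRight_apply,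
          LinearMap.comp_apply, AlgHom.toLinearMap_apply, sub_mul]
        abel
      rw [this]
      exact add_mem (symFil_mul_symι_mem (ih hy) Y)
        (rder_mem_symFil Y (sigmaTilde_envMk_mem hy))

/-- Solve `a * Y = a Y + rder Y a` for the product `a Y`: the left side is in the range because `a`
is, and `rder Y a` is in the range by the induction hypothesis. -/
lemma symFil_le_range_sigmaTilde (k : ℕ) :
    symFil m n k ≤ LinearMap.range (sigmaTilde (m := m) (n := n)) := by
  have one : (1 : SymAlg m n) ∈ LinearMap.range (sigmaTilde (m := m) (n := n)) :=
    ⟨1, sigmaTilde_one⟩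
  induction k with
  | zero =>
    refine Submodule.map_le_iff_le_comap.mpr (tenFil_zero_le ?_)
    simpa using one
  | succ k ih =>
    refine Submodule.map_le_iff_le_comap.mpr (tenFil_succ_le ?_ ?_)
    · exact fun y hy => ih ⟨y, hy, rfl⟩
    · intro y hy Y
      obtain ⟨u, hu⟩ := ih ⟨y, hy, rfl⟩
      have h : star Y (sigmaTilde u) ∈ LinearMap.range (sigmaTilde (m := m) (n := n)) :=
        ⟨_, sigmaTilde_mul u Y⟩
      have h2 := sub_mem h (ih (rder_mem_symFil Y ⟨y, hy, hu.symm⟩))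
      rw [star, LinearMap.add_apply, add_sub_cancel_right, hu] at h2
      simpa [symι] using h2

lemma sigmaTilde_surjective : Function.Surjective (sigmaTilde (m := m) (n := n)) := by
  intro a
  obtain ⟨x, rfl⟩ := symMk_surjective a
  obtain ⟨k, hk⟩ := exists_mem_tenFil x
  exact symFil_le_range_sigmaTilde k ⟨x, hk, rfl⟩

/-! ### Homogenization and the Rees algebra of `U(gl(m,n))` -/

/-- The homogenization map `X ↦ X t` from the tensor algebra to `U(gl(m,n))[t]`. -/
def homogenize (m n : ℕ) : TensorAlgebra ℂ (Gl m n) →ₐ[ℂ] Polynomial (EnvAlg m n) :=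
  TensorAlgebra.lift ℂ (((Polynomial.monomial 1).restrictScalars ℂ) ∘ₗ envι)

lemma homogenize_ι (X : Gl m n) :
    homogenize m n (TensorAlgebra.ι ℂ X) = Polynomial.monomial 1 (envι X) := by
  simp [homogenize]

/-- Setting `t = 1` undoes the homogenization. Evaluation is multiplicative here although the
coefficients do not commute, because `1` is central. -/
lemma eval_one_homogenize (x : TensorAlgebra ℂ (Gl m n)) :
    (homogenize m n x).eval 1 = envMk m n x := by
  induction x using TensorAlgebra.induction with
  | algebraMap r => simp [Polynomial.algebraMap_apply]
  | ι X => simp [homogenize_ι, envι]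
  | mul x y hx hy =>
    rw [map_mul, map_mul, ← hx, ← hy, Polynomial.eval,
      Polynomial.eval₂_mul_noncomm _ _ fun _ => Commute.one_right _]
    rfl
  | add x y hx hy => rw [map_add, map_add, ← hx, ← hy, Polynomial.eval_add]

/-- The homogenization takes values in the Rees algebra: each generator carries exactly one factor
`t`. -/
lemma coeff_homogenize_mem (x : TensorAlgebra ℂ (Gl m n)) (k : ℕ) :
    (homogenize m n x).coeff k ∈ envFil m n k := by
  induction x using TensorAlgebra.induction generalizing k with
  | algebraMap r =>
    rw [AlgHom.commutes, Polynomial.algebraMap_apply, Polynomial.coeff_C]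
    split_ifs with h
    · subst h
      exact ⟨algebraMap ℂ _ r, by rw [tenFil, pow_zero]; exact Submodule.algebraMap_mem r,
        by simp⟩
    · exact zero_mem _
  | ι X =>
    rw [homogenize_ι, Polynomial.coeff_monomial]
    split_ifs with h
    · subst h
      exact envι_mem_envFil X
    · exact zero_mem _
  | mul x y hx hy =>
    rw [map_mul, Polynomial.coeff_mul]
    refine sum_mem fun ij hij => ?_
    rw [← Finset.HasAntidiagonal.mem_antidiagonal.mp hij]
    exact envFil_mul_mem (hx _) (hy _)
  | add x y hx hy =>
    rw [map_add, Polynomial.coeff_add]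
    exact add_mem (hx k) (hy k)

lemma coeff_homogenize_of_mem {k : ℕ} {x : TensorAlgebra ℂ (Gl m n)} (hx : x ∈ tenFil m n k)
    {j : ℕ} (hj : k < j) : (homogenize m n x).coeff j = 0 := by
  induction k generalizing x j with
  | zero =>
    refine tenFil_zero_le (p := LinearMap.ker ((Polynomial.lcoeff (EnvAlg m n) j).restrictScalars ℂ
      ∘ₗ (homogenize m n).toLinearMap)) ?_ hx
    simp [Polynomial.coeff_one, hj.ne']
  | succ k ih =>
    refine tenFil_succ_le (p := LinearMap.ker
      ((Polynomial.lcoeff (EnvAlg m n) j).restrictScalars ℂ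
        ∘ₗ (homogenize m n).toLinearMap)) ?_ ?_ hx
    · exact fun y hy => ih hy (by omega)
    · intro y hy Y
      obtain ⟨i, rfl⟩ : ∃ i, j = i + 1 := ⟨j - 1, by omega⟩
      change (homogenize m n _).coeff _ = 0
      rw [map_mul, homogenize_ι, Polynomial.coeff_mul_monomial, ih hy (by omega), zero_mul]

/-- The homogeneous ideal of the tensors whose homogenization is divisible by `t` in the Rees
algebra of `U(gl(m,n))`. -/
def LowerOrder (x : TensorAlgebra ℂ (Gl m n)) : Prop :=
  (homogenize m n x).coeff 0 = 0 ∧ ∀ k, (homogenize m n x).coeff (k + 1) ∈ envFil m n k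

/-- One degree is saved in the factor `x`, and multiplicativity of the filtration passes the saving
on to the product. -/
lemma LowerOrder.mul_right {x : TensorAlgebra ℂ (Gl m n)} (hx : LowerOrder x)
    (y : TensorAlgebra ℂ (Gl m n)) : LowerOrder (x * y) := by
  refine ⟨by rw [map_mul, Polynomial.mul_coeff_zero, hx.1, zero_mul], fun k => ?_⟩
  rw [map_mul, Polynomial.coeff_mul]
  refine sum_mem fun ⟨i, j⟩ hij => ?_
  have hij := Finset.HasAntidiagonal.mem_antidiagonal.mp hij
  rcases i with _ | i
  · simp [hx.1]
  · obtain rfl : k = i + j := by simp at hij; omega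
    exact envFil_mul_mem (hx.2 i) (coeff_homogenize_mem y j)

lemma LowerOrder.mul_left {x : TensorAlgebra ℂ (Gl m n)} (hx : LowerOrder x)
    (y : TensorAlgebra ℂ (Gl m n)) : LowerOrder (y * x) := by
  refine ⟨by rw [map_mul, Polynomial.mul_coeff_zero, hx.1, mul_zero], fun k => ?_⟩
  rw [map_mul, Polynomial.coeff_mul]
  refine sum_mem fun ⟨i, j⟩ hij => ?_
  have hij := Finset.HasAntidiagonal.mem_antidiagonal.mp hij
  rcases j with _ | j
  · simp [hx.1]
  · obtain rfl : k = i + j := by simp at hij; omega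
    exact envFil_mul_mem (coeff_homogenize_mem y i) (hx.2 j)

lemma LowerOrder.neg {x : TensorAlgebra ℂ (Gl m n)} (hx : LowerOrder x) : LowerOrder (-x) := by
  simpa using hx.mul_left (-1)

lemma LowerOrder.add {x y : TensorAlgebra ℂ (Gl m n)} (hx : LowerOrder x) (hy : LowerOrder y) :
    LowerOrder (x + y) := by
  refine ⟨by rw [map_add, Polynomial.coeff_add, hx.1, hy.1, add_zero], fun k => ?_⟩
  rw [map_add, Polynomial.coeff_add]
  exact add_mem (hx.2 k) (hy.2 k)

lemma envι_bracket {p q : ZMod 2} {X Y : Gl m n} (hX : IsHom p X) (hY : IsHom q Y) :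
    envι X * envι Y - sgn (p * q) • (envι Y * envι X) = envι (X * Y - sgn (p * q) • (Y * X)) := by
  have h : envMk m n _ = envMk m n _ := RingQuot.mkAlgHom_rel ℂ (EnvRel.bracket hX hY)
  rw [map_sub, map_smul, map_mul, map_mul] at h
  exact h

lemma lowerOrder_of_symRel {x y : TensorAlgebra ℂ (Gl m n)} (h : SymRel m n x y) :
    LowerOrder (x - y) := by
  obtain ⟨hX, hY⟩ := h
  rename_i p q X Y
  -- The coefficient of `t ^ 2` is a superbracket, hence of degree one rather than two; this is
  -- where the relations of `U(gl(m,n))` enter.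
  have e : homogenize m n (TensorAlgebra.ι ℂ X * TensorAlgebra.ι ℂ Y
      - sgn (p * q) • (TensorAlgebra.ι ℂ Y * TensorAlgebra.ι ℂ X))
      = Polynomial.monomial 2 (envι (X * Y - sgn (p * q) • (Y * X))) := by
    rw [← envι_bracket hX hY, map_sub, map_smul, map_mul, map_mul, homogenize_ι, homogenize_ι,
      Polynomial.monomial_mul_monomial, Polynomial.monomial_mul_monomial, map_sub,
      Polynomial.smul_monomial]
  refine ⟨by simp [e, Polynomial.coeff_monomial], fun k => ?_⟩
  rw [e, Polynomial.coeff_monomial]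
  split_ifs with h
  · obtain rfl : k = 1 := by omega
    exact envι_mem_envFil _
  · exact zero_mem _

lemma lowerOrder_of_symMk_eq {x y : TensorAlgebra ℂ (Gl m n)} (h : symMk m n x = symMk m n y) :
    LowerOrder (x - y) := by
  have rel : ∀ x y, RingQuot.Rel (SymRel m n) x y → LowerOrder (x - y) := by
    intro x y h
    induction h with
    | of h => exact lowerOrder_of_symRel h
    | add_left _ ih => rwa [add_sub_add_right_eq_sub]
    | mul_left _ ih => rw [← sub_mul]; exact ih.mul_right _
    | mul_right _ ih => rw [← mul_sub]; exact ih.mul_left _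
  -- Equality in the quotient is unfolded to a finite chain of elementary relations, since no
  -- description of the kernel by a basis is at hand.
  have eqv : Relation.EqvGen (RingQuot.Rel (SymRel m n)) x y := by
    apply Quot.eqvGen_exact
    simp only [symMk, RingQuot.mkAlgHom_def, RingQuot.mkRingHom_def] at h
    exact congrArg RingQuot.toQuot h
  clear h
  induction eqv with
  | rel x y h => exact rel x y h
  | refl x => exact ⟨by simp, by simp⟩
  | symm x y _ ih => simpa using ih.neg
  | trans x y z _ _ ih₁ ih₂ => simpa using ih₁.add ih₂

/-! ### Descent in degree and injectivity -/

/-- An element of `U(gl(m,n))` of degree at most `k + 1` whose image has degree at most `k` has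
degree at most `k`. -/
lemma mem_envFil_of_sigmaTilde_mem {k : ℕ} {u : EnvAlg m n} (hu : u ∈ envFil m n (k + 1))
    (h : sigmaTilde u ∈ symFil m n k) : u ∈ envFil m n k := by
  obtain ⟨x, hx, rfl⟩ := hu
  change sigmaTilde (envMk m n x) ∈ _ at h
  -- Since `σ̃` preserves leading terms, the symbol of `x` has a representative `y` of degree at
  -- most `k`.
  obtain ⟨y, hy, hxy⟩ : symMk m n x ∈ symFil m n k := by
    simpa using sub_mem h (sigmaTilde_envMk_sub_mem hx)
  -- Compare the coefficients of `t ^ (k + 1)`: that of `y` vanishes, so that of `x` alone lies in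
  -- degree at most `k`. It is the only summand of `envMk m n x` not already known to lie there.
  have hlow := (lowerOrder_of_symMk_eq (x := x) (y := y) hxy.symm).2 k
  rw [map_sub, Polynomial.coeff_sub, coeff_homogenize_of_mem hy k.lt_succ_self, sub_zero] at hlow
  change envMk m n x ∈ _
  have hdeg : (homogenize m n x).natDegree < k + 2 :=
    Nat.lt_succ_of_le (Polynomial.natDegree_le_iff_coeff_eq_zero.mpr
      fun j hj => coeff_homogenize_of_mem hx hj)
  rw [← eval_one_homogenize, Polynomial.eval_eq_sum_range' hdeg]
  simp only [one_pow, mul_one]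
  rw [Finset.sum_range_succ]
  exact add_mem (sum_mem fun j hj => envFil_mono (Nat.le_of_lt_succ (Finset.mem_range.mp hj))
    (coeff_homogenize_mem x j)) hlow

lemma algebraMap_symAlg_injective : Function.Injective (algebraMap ℂ (SymAlg m n)) := by
  -- The augmentation, which kills every generator, is a left inverse.
  let ε : SymAlg m n →ₐ[ℂ] ℂ := symLift 0 (by simp)
  intro c d h
  simpa using congrArg ε h

lemma sigmaTilde_injective : Function.Injective (sigmaTilde (m := m) (n := n)) := by
  refine (injective_iff_map_eq_zero _).mpr fun u hu => ?_
  obtain ⟨x, rfl⟩ := envMk_surjective u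
  obtain ⟨k, hk⟩ := exists_mem_tenFil x
  have hmem : envMk m n x ∈ envFil m n k := ⟨x, hk, rfl⟩
  -- The image `0` lies in every filtration step, so the descent never stops before degree zero.
  have h0 : envMk m n x ∈ envFil m n 0 := by
    clear hk
    induction k with
    | zero => exact hmem
    | succ k ih => exact ih (mem_envFil_of_sigmaTilde_mem hmem (by rw [hu]; exact zero_mem _))
  obtain ⟨y, hy, hxy⟩ := h0
  rw [tenFil, pow_zero] at hy
  obtain ⟨c, rfl⟩ := Submodule.mem_one.mp hy
  change envMk m n _ = _ at hxy
  rw [AlgHom.commutes] at hxy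
  rw [← hxy, Algebra.algebraMap_eq_smul_one, map_smul, sigmaTilde_one,
    ← Algebra.algebraMap_eq_smul_one, map_eq_zero_iff _ algebraMap_symAlg_injective] at hu
  rw [← hxy, hu, map_zero]

/-! ### Comparison of the two actions on the tensor space -/

/-- The variant of `treeStep` that does not record the changed place. -/
def unmarkedStep {N : ℕ} (c d : Idx m n) :
    (TreeNode m n N →₀ ℂ) →ₗ[ℂ] (TreeNode m n N →₀ ℂ) :=
  Finsupp.linearCombination ℂ fun v =>
    ∑ t with t ∉ v.1 ∧ v.2 t = d,
      Finsupp.single (v.1, Function.update v.2 t c)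
        (sgn ((∑ q with q < t, par (v.2 q)) * (par c + par d)))

lemma treeStep_single {N : ℕ} (a b : Idx m n) (S : Finset (Fin N)) (k : Fin N → Idx m n) (z : ℂ) :
    treeStep a b (Finsupp.single (S, k) z) = ∑ t, if t ∉ S ∧ k t = b then
      Finsupp.single (insert t S, Function.update k t a)
        (z * sgn ((∑ q with q < t, par (k q)) * (par a + par b))) else 0 := by
  rw [treeStep, Finsupp.linearCombination_single, Finset.sum_filter, Finset.smul_sum]
  refine Finset.sum_congr rfl fun t _ => ?_
  split_ifs <;> simp

lemma unmarkedStep_single {N : ℕ} (c d : Idx m n) (S : Finset (Fin N)) (k : Fin N → Idx m n)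
    (z : ℂ) :
    unmarkedStep c d (Finsupp.single (S, k) z) = ∑ t, if t ∉ S ∧ k t = d then
      Finsupp.single (S, Function.update k t c)
        (z * sgn ((∑ q with q < t, par (k q)) * (par c + par d))) else 0 := by
  rw [unmarkedStep, Finsupp.linearCombination_single, Finset.sum_filter, Finset.smul_sum]
  refine Finset.sum_congr rfl fun t _ => ?_
  split_ifs <;> simp

lemma treeGen_E_mul_E {N : ℕ} (a b c d : Idx m n) :
    treeGen N (E a b * E c d) = if b = c then treeStep a d else 0 := by
  split_ifs with h
  · subst h
    rw [E, E, Matrix.single_mul_single_same, mul_one]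
    exact treeGen_E a d
  · rw [E, E, Matrix.single_mul_single_of_ne _ _ _ _ h, map_zero]

/-- The second step excludes only `S`, so `t = s` is allowed. In the opposite order, where the
marking step comes first, `t` has been marked and `s = t` is excluded. -/
lemma treeStep_mul_unmarkedStep_single {N : ℕ} (a b c d : Idx m n) (S : Finset (Fin N))
    (k : Fin N → Idx m n) :
    treeStep a b (unmarkedStep c d (Finsupp.single (S, k) 1)) =
      ∑ s, ∑ t, if (s ∉ S ∧ k s = d) ∧ t ∉ S ∧ Function.update k s c t = b then
        Finsupp.single (insert t S, Function.update (Function.update k s c) t a)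
          (sgn ((∑ q with q < s, par (k q)) * (par c + par d)
            + (∑ q with q < t, par (Function.update k s c q)) * (par a + par b))) else 0 := by
  rw [unmarkedStep_single, map_sum]
  refine Finset.sum_congr rfl fun s _ => ?_
  by_cases h : s ∉ S ∧ k s = d
  · simp only [h, treeStep_single, one_mul, sgn_add, not_false_eq_true, and_self, true_and,
      if_true]
  · simp only [h, if_false, map_zero, false_and, Finset.sum_const_zero]

lemma unmarkedStep_mul_treeStep_single {N : ℕ} (a b c d : Idx m n) (S : Finset (Fin N))
    (k : Fin N → Idx m n) :
    unmarkedStep c d (treeStep a b (Finsupp.single (S, k) 1)) =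
      ∑ t, ∑ s, if (t ∉ S ∧ k t = b) ∧ s ∉ insert t S ∧ Function.update k t a s = d then
        Finsupp.single (insert t S, Function.update (Function.update k t a) s c)
          (sgn ((∑ q with q < t, par (k q)) * (par a + par b)
            + (∑ q with q < s, par (Function.update k t a q)) * (par c + par d))) else 0 := by
  rw [treeStep_single, map_sum]
  refine Finset.sum_congr rfl fun t _ => ?_
  by_cases h : t ∉ S ∧ k t = b
  · simp only [h, unmarkedStep_single, one_mul, sgn_add, not_false_eq_true, and_self, true_and,
      if_true]
  · simp only [h, if_false, map_zero, false_and, Finset.sum_const_zero]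

/-- Two factors acting at different places supercommute; acting at the same place, they act
through the matrix product. -/
lemma treeStep_mul_unmarkedStep {N : ℕ} (a b c d : Idx m n) :
    treeStep (N := N) a b * unmarkedStep c d = treeGen N (E a b * E c d) +
      sgn ((par c + par d) * (par a + par b)) • (unmarkedStep c d * treeStep a b) := by
  refine Finsupp.lhom_ext' fun v => LinearMap.ext_ring ?_
  obtain ⟨S, k⟩ := v
  change treeStep a b (unmarkedStep c d (Finsupp.single (S, k) 1)) =
    treeGen N (E a b * E c d) (Finsupp.single (S, k) 1) +
      sgn _ • unmarkedStep c d (treeStep a b (Finsupp.single (S, k) 1))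
  -- The matrix product term is written as a double sum supported on `s = t`, so that the whole
  -- identity can be checked for each pair of places.
  have diag : treeGen N (E a b * E c d) (Finsupp.single (S, k) 1) =
      ∑ s, ∑ t, if s = t then (if b = c ∧ t ∉ S ∧ k t = d then
        Finsupp.single (insert t S, Function.update k t a)
          (sgn ((∑ q with q < t, par (k q)) * (par a + par d))) else 0) else 0 := by
    simp only [Finset.sum_ite_eq, Finset.mem_univ, if_true]
    rw [treeGen_E_mul_E]
    by_cases h : b = c
    · simp [h, treeStep_single]
    · simp [h]
  rw [diag, treeStep_mul_unmarkedStep_single, unmarkedStep_mul_treeStep_single,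
    Finset.sum_comm (f := fun t s => if (t ∉ S ∧ k t = b) ∧ s ∉ insert t S ∧ _ then _ else _)]
  simp only [Finset.smul_sum]
  rw [← Finset.sum_add_distrib]
  refine Finset.sum_congr rfl fun s _ => ?_
  rw [← Finset.sum_add_distrib]
  refine Finset.sum_congr rfl fun t _ => ?_
  by_cases hst : s = t
  · subst hst
    have hno : ¬((s ∉ S ∧ k s = b) ∧ s ∉ insert s S ∧ Function.update k s a s = d) := by simp
    rw [if_neg hno, smul_zero, add_zero, if_pos rfl, Function.update_self, Function.update_idem,
      sum_par_update, if_neg (lt_irrefl s), add_zero]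
    by_cases hc : b = c ∧ s ∉ S ∧ k s = d
    · obtain ⟨rfl, h1, h2⟩ := hc
      rw [if_pos ⟨⟨h1, h2⟩, h1, rfl⟩, if_pos ⟨rfl, h1, h2⟩]
      congr 2
      -- With `b = c` the parities of `E_{ab}` and `E_{bd}` add up to that of `E_{ad}`.
      linear_combination (∑ q with q < s, par (k q)) * CharTwo.add_self_eq_zero (par b)
    · rw [if_neg hc, if_neg]
      tauto
  have hts : t ≠ s := fun h => hst h.symm
  rw [Function.update_of_ne hts, Function.update_of_ne hst, if_neg hst, zero_add]
  by_cases hc : (s ∉ S ∧ k s = d) ∧ t ∉ S ∧ k t = b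
  · obtain ⟨⟨h1, h2⟩, h3, h4⟩ := hc
    rw [if_pos (by simp [h1, h2, h3, h4]), if_pos (by simp [h1, h2, h3, h4, hst]),
      Finsupp.smul_single, Function.update_comm hst, smul_eq_mul, ← sgn_add,
      sum_par_update, sum_par_update, h2, h4]
    congr 2
    have two : (2 : ZMod 2) = 0 := rfl
    -- A change at one place affects the sign only of a later step to its right. So for `s < t` the
    -- extra sign arises on the left-hand side, and for `t < s` it arises on the right-hand side and
    -- cancels the prefactor.
    rcases lt_or_gt_of_ne hst with h | h
    · rw [if_pos h, if_neg h.not_gt]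
      ring
    · rw [if_pos h, if_neg h.not_gt]
      linear_combination -((par a + par b) * (par c + par d)) * two
  · rw [if_neg hc, if_neg, smul_zero]
    simp only [Finset.mem_insert, not_or]
    tauto

lemma treeHom_symι {N : ℕ} (X : Gl m n) : treeHom m n N (symι X) = treeGen N X :=
  symLift_symι (B := Module.End ℂ (TreeNode m n N →₀ ℂ)) _ _ _

/-! ### Passing between tensors and nodes -/

/-- The tensor given by a formal linear combination of nodes. -/
def nodeTensor (m n N : ℕ) : (TreeNode m n N →₀ ℂ) →ₗ[ℂ] TensorSpace m n N :=
  Finsupp.linearCombination ℂ fun v => tensorBasis m n N v.2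

/-- The map sending a basis tensor to the root of its tree. -/
def rootNode (m n N : ℕ) : TensorSpace m n N →ₗ[ℂ] (TreeNode m n N →₀ ℂ) :=
  (tensorBasis m n N).constr ℂ fun j => Finsupp.single (∅, j) 1

lemma rootNode_tensorBasis {N : ℕ} (j : Fin N → Idx m n) :
    rootNode m n N (tensorBasis m n N j) = Finsupp.single (∅, j) 1 :=
  Module.Basis.constr_basis _ _ _ _

/-- Factors the action as root, tree, evaluation of the last level. Only the middle map is
multiplicative in `a`; the action itself is not, because evaluation forgets the marks. -/
lemma symAction_eq {N : ℕ} (a : SymAlg m n) :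
    symAction m n N a = nodeTensor m n N ∘ₗ treeHom m n N a ∘ₗ rootNode m n N := by
  refine (tensorBasis m n N).ext fun j => ?_
  rw [LinearMap.comp_apply, LinearMap.comp_apply, rootNode_tensorBasis]
  exact (tensorBasis m n N).constr_basis ℂ _ j

lemma nodeTensor_unmarkedStep {N : ℕ} (c d : Idx m n) (v : TreeNode m n N →₀ ℂ) :
    nodeTensor m n N (unmarkedStep c d v) = nodeTensor m n N (treeStep c d v) := by
  suffices h : nodeTensor m n N ∘ₗ unmarkedStep c d = nodeTensor m n N ∘ₗ treeStep c d from
    LinearMap.congr_fun h v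
  refine Finsupp.lhom_ext' fun v => LinearMap.ext_ring ?_
  obtain ⟨S, k⟩ := v
  simp only [LinearMap.comp_apply, Finsupp.lsingle_apply, unmarkedStep_single, treeStep_single,
    map_sum]
  refine Finset.sum_congr rfl fun t _ => ?_
  split_ifs
  · simp [nodeTensor]
  · simp

/-- Moving the unmarked step left past each factor of `a` leaves behind the product terms that make
up `rder (E c d) a`. Once it stands leftmost, its missing mark is invisible in the tensor, so it may
be replaced by a marked step. -/
lemma nodeTensor_treeHom_unmarkedStep {N : ℕ} (c d : Idx m n) (a : SymAlg m n)
    (v : TreeNode m n N →₀ ℂ) :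
    nodeTensor m n N (treeHom m n N a (unmarkedStep c d v)) =
      nodeTensor m n N (treeHom m n N a (treeStep c d v)) +
        nodeTensor m n N (treeHom m n N (rder (E c d) a) v) := by
  induction a using sym_induction generalizing v with
  | one => simp [rder_one, nodeTensor_unmarkedStep]
  | add a b ha hb =>
    simp only [map_add, LinearMap.add_apply, ha, hb]
    abel
  | smul z a ha => simp only [map_smul, LinearMap.smul_apply, ha, smul_add]
  | mul a i j ha =>
    have h₁ := LinearMap.congr_fun (treeStep_mul_unmarkedStep (N := N) i j c d) v
    -- After the induction hypothesis has turned the unmarked step into a marked one, this brings it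
    -- back to the right of `E_{ij}` and absorbs the sign.
    have h₂ := LinearMap.congr_fun (treeStep_swap (N := N) i j c d) v
    rw [mul_comm (par i + par j)] at h₂
    simp only [Module.End.mul_apply, LinearMap.add_apply, LinearMap.smul_apply] at h₁ h₂
    rw [rder_mul (isHom_E c d) (isHom_E i j)]
    simp only [map_add, map_smul, map_mul, Module.End.mul_apply, LinearMap.add_apply,
      LinearMap.smul_apply, treeHom_symι (E i j * E c d), treeHom_E, h₁, h₂, ha, smul_add]
    abel

/-! ### The vector representation on basis tensors -/

lemma tensorBasis_apply {N : ℕ} (j : Fin N → Idx m n) :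
    tensorBasis m n N j = PiTensorProduct.tprod ℂ fun q => Pi.single (j q) (1 : ℂ) := by
  simp [tensorBasis, Basis.piTensorProduct_apply]

lemma parOp_single (d : ZMod 2) (i : Idx m n) :
    parOp m n d (Pi.single i 1) = sgn (d * par i) • Pi.single i (1 : ℂ) := by
  ext r
  by_cases h : r = i
  · subst h; simp [parOp]
  · simp [parOp, Matrix.mulVec_diagonal, h]

lemma toLin'_E_single (c d i : Idx m n) :
    Matrix.toLin' (E c d : Gl m n) (Pi.single i (1 : ℂ)) = if i = d then Pi.single c 1 else 0 := by
  ext r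
  by_cases h : i = d
  · subst h
    simp [E, Matrix.single_apply, Pi.single_apply, eq_comm]
  · simp [E, h, Ne.symm h]

lemma sgn_sum {ι : Type*} (s : Finset ι) (f : ι → ZMod 2) :
    sgn (∑ i ∈ s, f i) = ∏ i ∈ s, sgn (f i) := by
  classical
  induction s using Finset.induction_on with
  | empty => simp [sgn]
  | insert i s hi ih => rw [Finset.sum_insert hi, Finset.prod_insert hi, sgn_add, ih]

lemma placeOp_E_tensorBasis {N : ℕ} (p : ZMod 2) (t : Fin N) (c d : Idx m n)
    (j : Fin N → Idx m n) :
    placeOp N p t (E c d) (tensorBasis m n N j) =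
      if j t = d then sgn ((∑ q with q < t, par (j q)) * p) •
        tensorBasis m n N (Function.update j t c) else 0 := by
  rw [placeOp_eq, tensorBasis_apply, PiTensorProduct.map_tprod]
  split_ifs with h
  -- Each place to the left of `t` contributes its own sign; multilinearity collects them into the
  -- sign of the partial sum of parities.
  · have e : (fun q => slot p t (E c d) q (Pi.single (j q) 1)) = fun q =>
        (if q < t then sgn (par (j q) * p) else 1) •
          (Pi.single (Function.update j t c q) (1 : ℂ) : Idx m n → ℂ) := by
      ext1 q
      rcases lt_trichotomy q t with hq | hq | hq
      · simp [slot, hq, hq.ne, parOp_single, mul_comm]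
      · subst hq
        have hs : slot p q (E c d) q = Matrix.toLin' (E c d) := by simp [slot]
        simp only [hs, toLin'_E_single, if_pos h, lt_irrefl, if_false, one_smul,
          Function.update_self]
      · simp [slot, hq.not_gt, hq.ne']
    rw [e, MultilinearMap.map_smul_univ, tensorBasis_apply, Finset.sum_mul, sgn_sum,
      Finset.prod_filter]
  · refine MultilinearMap.map_coord_zero _ t ?_
    have hs : slot p t (E c d) t = Matrix.toLin' (E c d) := by simp [slot]
    simp only [hs, toLin'_E_single, if_neg h]

/-- At a root no place is marked, so `unmarkedStep` runs over all places and again yields roots: it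
is the action on the tensor power. -/
lemma rootNode_tensorGen {N : ℕ} (c d : Idx m n) (v : TensorSpace m n N) :
    rootNode m n N (tensorGen N (E c d) v) = unmarkedStep c d (rootNode m n N v) := by
  suffices h : rootNode m n N ∘ₗ tensorGen N (E c d) = unmarkedStep c d ∘ₗ rootNode m n N from
    LinearMap.congr_fun h v
  refine (tensorBasis m n N).ext fun j => ?_
  rw [LinearMap.comp_apply, LinearMap.comp_apply, rootNode_tensorBasis, unmarkedStep_single,
    tensorGen_of_isHom (isHom_E c d), LinearMap.sum_apply, map_sum]
  refine Finset.sum_congr rfl fun t _ => ?_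
  rw [placeOp_E_tensorBasis]
  by_cases h : j t = d
  · simp [h, rootNode_tensorBasis]
  · simp [h]

/-! ### Agreement of the two actions -/

lemma symAction_star_E {N : ℕ} (c d : Idx m n) (a : SymAlg m n) :
    symAction m n N (star (E c d) a) = symAction m n N a * tensorGen N (E c d) := by
  refine LinearMap.ext fun v => ?_
  rw [symAction_eq, symAction_eq, Module.End.mul_apply]
  simp only [LinearMap.comp_apply, rootNode_tensorGen, nodeTensor_treeHom_unmarkedStep, star,
    LinearMap.add_apply, LinearMap.mulRight_apply, map_add, map_mul, Module.End.mul_apply,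
    treeHom_E]

lemma symAction_star {N : ℕ} (X : Gl m n) (a : SymAlg m n) :
    symAction m n N (star X a) = symAction m n N a * tensorGen N X := by
  -- Both sides are presented as linear maps in `X`, through `starOp`, so that matrix units suffice.
  suffices h : symAction m n N ∘ₗ LinearMap.applyₗ a ∘ₗ
      (MulOpposite.opLinearEquiv ℂ).symm.toLinearMap ∘ₗ starOp =
        LinearMap.mulLeft ℂ (symAction m n N a) ∘ₗ tensorGen N from LinearMap.congr_fun h X
  exact Matrix.ext_linearMap ℂ fun c d => LinearMap.ext_ring (symAction_star_E c d a)

/-- An arbitrary starting point `a` is needed for products: `x y` first acts on `a` through `x`, and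
then `y` acts on the result. The comparison for `σ̃` is the case `a = 1`. -/
lemma symAction_starHom {N : ℕ} (x : TensorAlgebra ℂ (Gl m n)) (a : SymAlg m n) :
    symAction m n N ((starHom (envMk m n x)).unop a) =
      symAction m n N a * envAction m n N (envMk m n x) := by
  induction x using TensorAlgebra.induction generalizing a with
  | algebraMap r =>
    simp [Algebra.algebraMap_eq_smul_one]
  | ι X =>
    have h₁ : starHom (envMk m n (TensorAlgebra.ι ℂ X)) = starOp X := envLift_envι _ _ _
    have h₂ : envAction m n N (envMk m n (TensorAlgebra.ι ℂ X)) = tensorGen N X :=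
      envLift_envι (B := Module.End ℂ (TensorSpace m n N)) _ _ _
    rw [h₁, h₂]
    exact symAction_star X a
  | mul x y hx hy =>
    simp only [map_mul, MulOpposite.unop_mul, Module.End.mul_apply, hy, hx, mul_assoc]
  | add x y hx hy =>
    simp only [map_add, MulOpposite.unop_add, LinearMap.add_apply, hx, hy, mul_add]

lemma symAction_sigmaTilde {N : ℕ} (u : EnvAlg m n) :
    symAction m n N (sigmaTilde u) = envAction m n N u := by
  obtain ⟨x, rfl⟩ := envMk_surjective u
  have one : symAction m n N 1 = 1 := by
    refine (tensorBasis m n N).ext fun j => ?_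
    simp [symAction_eq, rootNode_tensorBasis, nodeTensor]
  have h := symAction_starHom (N := N) x 1
  rw [one, one_mul] at h
  exact h

end SuperGL
end

theorem corollary2p3 (m n : ℕ) :
    ∃ σ : SuperGL.SymAlg m n ≃ₗ[ℂ] SuperGL.EnvAlg m n,
      (∀ u : SuperGL.EnvAlg m n, σ.symm u = SuperGL.sigmaTilde u) ∧
      ∀ (N : ℕ) (a : SuperGL.SymAlg m n),
        SuperGL.symAction m n N a = SuperGL.envAction m n N (σ a) := by
  refine ⟨(LinearEquiv.ofBijective SuperGL.sigmaTilde
    ⟨SuperGL.sigmaTilde_injective, SuperGL.sigmaTilde_surjective⟩).symm, fun u => rfl,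
    fun N a => ?_⟩
  rw [← SuperGL.symAction_sigmaTilde]
  congr 1
  exact (LinearEquiv.apply_symm_apply (LinearEquiv.ofBijective SuperGL.sigmaTilde _) a).symm
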